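/- Let $A_t=\begin{pmatrix}0&1\\1&0\end{pmatrix}$ for odd $t$ and $A_t=\begin{pmatrix}0&-1\\-1&0\end{pmatrix}$ for even $t$ $(t\in\mathbb Z,\ t\ge -1)$, and let $\Delta_2=\{(u_1,u_2): u_1,u_2\ge 0,\ u_1+u_2=1\}$. For a step size $\eta>0$ and initial strategies $(\mathbf x_1^{-1},\mathbf x_2^{-1}),(\mathbf x_1^{0},\mathbf x_2^{0})\in\Delta_2\times\Delta_2$, Optimistic MWU in the 2-periodic zero-sum game $(A_t)$ is defined for $t\ge 0$ and $i\in\{1,2\}$ by $$\mathbf x_{1,i}^{t+1}=\frac{\mathbf x_{1,i}^{t}\,e^{2\eta (A_t\mathbf x_2^t)_i-\eta(A_{t-1}\mathbf x_2^{t-1})_i}}{\sum_{s=1}^2\mathbf x_{1,s}^{t}\,e^{2\eta (A_t\mathbf x_2^t)_s-\eta(A_{t-1}\mathbf x_2^{t-1})_s}},\qquad \mathbf x_{2,i}^{t+1}=\frac{\mathbf x_{2,i}^{t}\,e^{-2\eta (A_t^\top\mathbf x_1^t)_i+\eta(A_{t-1}^\top\mathbf x_1^{t-1})_i}}{\sum_{s=1}^2\mathbf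 x_{2,s}^{t}\,e^{-2\eta (A_t^\top\mathbf x_1^t)_s+\eta(A_{t-1}^\top\mathbf x_1^{t-1})_s}}.$$ Let $\mathbf x_1^*=\mathbf x_2^*=(\tfrac12,\tfrac12)$ be the equilibrium, and let $$\mathrm{KL}\big((\mathbf x_1^*,\mathbf x_2^*),(\mathbf x_1,\mathbf x_2)\big)=\sum_{j=1}^2\sum_{i=1}^2\mathbf x_{j,i}^*\ln\frac{\mathbf x_{j,i}^*}{\mathbf x_{j,i}}\in[0,+\infty],$$ which is $+\infty$ if some $\mathbf x_{j,i}=0$. Then, for sufficiently small $\eta$ and every initial point $(\mathbf x_1^0,\mathbf x_2^0)\ne(\mathbf x_1^*,\mathbf x_2^*)$, $$\lim_{t\to\infty}\mathrm{KL}\big((\mathbf x_1^*,\mathbf x_2^*),(\mathbf x_1^t,\mathbf x_2^t)\big)=+\infty,$$ and $(\mathbf x_1^t,\mathbf x_2^t)$ does not converge to $(\mathbf x_1^*,\mathbf x_2^*)$, in each of the following two senses. 1. For every $(\mathbf x_1^0,\mathbf x_2^0)\ne(\mathbf x_1^*,\mathbf x_2^*)$ in $\Delta_2\times\Delta_2$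 the conclusion holds for every $(\mathbf x_1^{-1},\mathbf x_2^{-1})\in\Delta_2\times\Delta_2$ and every $\eta>0$ with $16\sqrt\eta\le p$, where $p=\tfrac12\max\big(|\mathbf x_{1,1}^0-\tfrac12|,|\mathbf x_{2,1}^0-\tfrac12|\big)$. 2. There is an absolute constant $\eta_0>0$ such that, for every $0<\eta<\eta_0$, the conclusion holds for every $(\mathbf x_1^0,\mathbf x_2^0)\ne(\mathbf x_1^*,\mathbf x_2^*)$ in $\Delta_2\times\Delta_2$ with $(\mathbf x_1^{-1},\mathbf x_2^{-1})=(\mathbf x_1^0,\mathbf x_2^0)$. -/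

import Mathlib

open Filter Topology

noncomputable section

/-- A pair of strategy vectors, one for each player. -/
abbrev Profile (m n : ℕ) : Type := (Fin m → ℝ) × (Fin n → ℝ)

/-- The set of pairs of mixed strategies. -/
def mixedProfiles (m n : ℕ) : Set (Profile m n) :=
  stdSimplex ℝ (Fin m) ×ˢ stdSimplex ℝ (Fin n)

/-- Multiplicative weights: the weight `x i` is multiplied by `exp (g i)`, then normalized. -/
def mwUpdate {n : ℕ} (x g : Fin n → ℝ) : Fin n → ℝ :=
  fun i => x i * Real.exp (g i) / ∑ s, x s * Real.exp (g s)

/-- One step of Optimistic MWU. `A` is the current payoff matrix and `A'` the previous one, `z` is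
the current profile and `z'` the previous one. Player 1 maximizes `x₁ᵀ A x₂`, player 2 minimizes
it. -/
def omwuStep {m n : ℕ} (η : ℝ) (A' A : Matrix (Fin m) (Fin n) ℝ) (z' z : Profile m n) :
    Profile m n :=
  (mwUpdate z.1 ((2 * η) • A.mulVec z.2 - η • A'.mulVec z'.2),
   mwUpdate z.2 (-((2 * η) • A.transpose.mulVec z.1 - η • A'.transpose.mulVec z'.1)))

/-- The pair (profile at time `t - 1`, profile at time `t`) of Optimistic MWU in the time-varying
zero-sum game `A`, started from the profile `zm` at time `-1` and `z0` at time `0`. -/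
def omwuPair {m n : ℕ} (η : ℝ) (A : ℤ → Matrix (Fin m) (Fin n) ℝ) (zm z0 : Profile m n) :
    ℕ → Profile m n × Profile m n
  | 0 => (zm, z0)
  | t + 1 =>
    ((omwuPair η A zm z0 t).2,
      omwuStep η (A ((t : ℤ) - 1)) (A (t : ℤ))
        (omwuPair η A zm z0 t).1 (omwuPair η A zm z0 t).2)

/-- The profile of Optimistic MWU at time `t`. -/
def omwu {m n : ℕ} (η : ℝ) (A : ℤ → Matrix (Fin m) (Fin n) ℝ) (zm z0 : Profile m n) (t : ℕ) :
    Profile m n :=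
  (omwuPair η A zm z0 t).2

/-- The payoff matrices of the 2-periodic game. -/
def periodicGame (t : ℤ) : Matrix (Fin 2) (Fin 2) ℝ :=
  if Odd t then !![0, 1; 1, 0] else !![0, -1; -1, 0]

/-- The equilibrium of the 2-periodic game. -/
def equilibrium : Profile 2 2 := (![1 / 2, 1 / 2], ![1 / 2, 1 / 2])

open Classical in
/-- The Kullback–Leibler divergence of probability vectors; it is infinite if `q` vanishes
somewhere where `p` does not. -/
def klVec {n : ℕ} (p q : Fin n → ℝ) : EReal :=
  if ∃ i, p i ≠ 0 ∧ q i = 0 then ⊤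
  else ((∑ i, p i * Real.log (p i / q i) : ℝ) : EReal)

/-- The KL-divergence of profiles: the sum over the two players. -/
def klProfile {m n : ℕ} (w z : Profile m n) : EReal :=
  klVec w.1 z.1 + klVec w.2 z.2

end

/-!
Write `θ` for half the log-odds of a strategy, so that `tanh θ` is its bias `x₀ - x₁`. In these
coordinates the KL-divergence of the equilibrium is `L = log (cosh X) + log (cosh Y)`. Because the
game alternates, the extrapolation `2 A_t - A_{t-1}` looks in the wrong direction. Over two steps
the first-order terms cancel, and with `p = tanh X`, `q = tanh Y` and `ε = η / 2` the second-order
Taylor expansion leaves the outward displacement `3 ε² ((1 - q²) p, (1 - p²) q)`, with a relative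
error of order `ε` in terms of `max |p| |q|`. As `log ∘ cosh` lies above its tangents, `L` grows
over two steps by at least `ε² ((1 - p²) q² + (1 - q²) p²) ≥ 2 ε² e^{-L} (1 - e^{-L})`, so it has no
finite limit. A trajectory that starts on the boundary of the simplex stays there, where `L` is
infinite.
-/

noncomputable section

open Real

/-! ### Hyperbolic tangent and sequences -/

lemma one_sub_tanh_sq (x : ℝ) : 1 - tanh x ^ 2 = (cosh x ^ 2)⁻¹ := by
  have hx := (cosh_pos x).ne'
  rw [tanh_eq_sinh_div_cosh]
  field_simp
  exact cosh_sq_sub_sinh_sq x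

lemma one_sub_tanh_sq_nonneg (x : ℝ) : 0 ≤ 1 - tanh x ^ 2 := by
  rw [one_sub_tanh_sq]; positivity

lemma hasDerivAt_tanh (x : ℝ) : HasDerivAt tanh (1 - tanh x ^ 2) x := by
  have hx := (cosh_pos x).ne'
  have h := (hasDerivAt_sinh x).div (hasDerivAt_cosh x) hx
  rw [show (sinh / cosh : ℝ → ℝ) = tanh from funext fun y => (tanh_eq_sinh_div_cosh y).symm] at h
  refine h.congr_deriv ?_
  rw [tanh_eq_sinh_div_cosh]
  field_simp

lemma abs_tanh_sub_tanh_le (x y : ℝ) : |tanh x - tanh y| ≤ |x - y| := by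
  have hderiv (z : ℝ) : ‖1 - tanh z ^ 2‖ ≤ 1 := by
    rw [norm_of_nonneg (one_sub_tanh_sq_nonneg z)]
    linarith [sq_nonneg (tanh z)]
  simpa using convex_univ.norm_image_sub_le_of_norm_hasDerivWithin_le
    (fun z _ => (hasDerivAt_tanh z).hasDerivWithinAt) (fun z _ => hderiv z)
    (Set.mem_univ y) (Set.mem_univ x)

lemma tanh_add_sub_tanh (x h : ℝ) : tanh (x + h) - tanh x =
    (1 - tanh x ^ 2) / 2 *
      ((exp (2 * h) - 1) / (1 + (1 + tanh x) / 2 * (exp (2 * h) - 1))) := by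
  have hh : exp (2 * h) = exp h ^ 2 := by rw [two_mul, exp_add, sq]
  rw [hh, tanh_eq, tanh_eq, neg_add, exp_add, exp_add, exp_neg, exp_neg]
  have := exp_pos x
  have := exp_pos h
  have : 1 + (1 + (exp x - (exp x)⁻¹) / (exp x + (exp x)⁻¹)) / 2 * (exp h ^ 2 - 1) =
    (exp x ^ 2 * exp h ^ 2 + 1) / (exp x ^ 2 + 1) := by
    field_simp
    ring
  rw [this]
  field_simp
  ring

-- The quotient is antitone in `w`, with value `exp h - 1` at `w = 0` and `1 - exp (-h)` at `w = 1`.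
lemma abs_div_one_add_mul_sub_le {w h : ℝ} (hw : 0 ≤ w) (hw' : w ≤ 1) (hh : |h| ≤ 1) :
    |(exp h - 1) / (1 + w * (exp h - 1)) - h| ≤ h ^ 2 := by
  have hexp := exp_pos h
  have hden : 0 < 1 + w * (exp h - 1) := by
    rcases hw.eq_or_lt with rfl | hw0
    · simp
    · linarith [mul_pos hw0 hexp]
  have hupper : (exp h - 1) / (1 + w * (exp h - 1)) ≤ exp h - 1 := by
    rw [div_le_iff₀ hden]
    nlinarith [mul_nonneg hw (sq_nonneg (exp h - 1))]
  have hlower : 1 - exp (-h) ≤ (exp h - 1) / (1 + w * (exp h - 1)) := by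
    rw [exp_neg, ← one_div, one_sub_div hexp.ne', div_le_div_iff₀ hexp hden]
    nlinarith [mul_nonneg (sub_nonneg.2 hw') (sq_nonneg (exp h - 1))]
  have hpos := abs_le.1 (abs_exp_sub_one_sub_id_le hh)
  have hneg := abs_le.1 (abs_exp_sub_one_sub_id_le (x := -h) (by rwa [abs_neg]))
  rw [neg_sq] at hneg
  exact abs_le.2 ⟨by linarith, by linarith⟩

lemma abs_tanh_add_sub_tanh_sub_le (x : ℝ) {h : ℝ} (hh : |h| ≤ 1 / 2) :
    |tanh (x + h) - tanh x - (1 - tanh x ^ 2) * h| ≤ 2 * (1 - tanh x ^ 2) * h ^ 2 := by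
  have ht := abs_lt.1 (abs_tanh_lt_one x)
  have hx := one_sub_tanh_sq_nonneg x
  have key := abs_div_one_add_mul_sub_le (w := (1 + tanh x) / 2) (h := 2 * h)
    (by linarith) (by linarith) (by rw [abs_mul, abs_two]; linarith)
  calc |tanh (x + h) - tanh x - (1 - tanh x ^ 2) * h|
      = (1 - tanh x ^ 2) / 2 *
        |(exp (2 * h) - 1) / (1 + (1 + tanh x) / 2 * (exp (2 * h) - 1)) - 2 * h| := by
        rw [tanh_add_sub_tanh, ← abs_of_nonneg (div_nonneg hx zero_le_two), ← abs_mul,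
          abs_of_nonneg (div_nonneg hx zero_le_two)]
        ring_nf
    _ ≤ (1 - tanh x ^ 2) / 2 * (2 * h) ^ 2 := by gcongr
    _ = 2 * (1 - tanh x ^ 2) * h ^ 2 := by ring

lemma abs_sign_mul_tanh_add_sub_tanh_sub_le {σ : ℝ} (hσ : |σ| = 1) (x : ℝ) {h : ℝ}
    (hh : |h| ≤ 1 / 2) :
    |σ * (tanh (x + σ * h) - tanh x) - (1 - tanh x ^ 2) * h| ≤ 2 * (1 - tanh x ^ 2) * h ^ 2 := by
  have hσσ : σ ^ 2 = 1 := by rw [← sq_abs, hσ, one_pow]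
  have htaylor := abs_tanh_add_sub_tanh_sub_le x (h := σ * h) (by rwa [abs_mul, hσ, one_mul])
  rw [mul_pow, hσσ, one_mul] at htaylor
  convert htaylor using 1
  rw [← one_mul |tanh (x + σ * h) - _ - (1 - tanh x ^ 2) * (σ * h)|, ← hσ, ← abs_mul, hσ]
  congr 1
  linear_combination (1 - tanh x ^ 2) * h * hσσ

lemma abs_two_mul_tanh_add_tanh_le (x y : ℝ) : |2 * tanh x + tanh y| ≤ 3 := by
  have hx := abs_lt.1 (abs_tanh_lt_one x)
  have hy := abs_lt.1 (abs_tanh_lt_one y)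
  exact abs_le.2 ⟨by linarith, by linarith⟩

-- `cosh y / cosh x` is the mean of `exp (±(y - x))` with weights `(1 ± tanh x) / 2`, so Jensen's
-- inequality applies.
lemma tanh_mul_sub_le_log_cosh_sub (x y : ℝ) :
    tanh x * (y - x) ≤ log (cosh y) - log (cosh x) := by
  have hx := cosh_pos x
  have ht := abs_lt.1 (abs_tanh_lt_one x)
  rw [← log_div (cosh_pos y).ne' hx.ne', le_log_iff_exp_le (div_pos (cosh_pos y) hx)]
  have hratio : cosh y / cosh x = cosh (y - x) + tanh x * sinh (y - x) := by
    rw [tanh_eq_sinh_div_cosh]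
    field_simp
    rw [← cosh_add, add_sub_cancel]
  have hjensen := convexOn_exp.2 (Set.mem_univ (y - x)) (Set.mem_univ (-(y - x)))
    (show 0 ≤ (1 + tanh x) / 2 by linarith) (show 0 ≤ (1 - tanh x) / 2 by linarith) (by ring)
  simp only [smul_eq_mul] at hjensen
  rw [show (1 + tanh x) / 2 * (y - x) + (1 - tanh x) / 2 * -(y - x) = tanh x * (y - x) by ring]
    at hjensen
  rw [hratio, cosh_eq, sinh_eq]
  linarith

lemma mul_sub_abs_mul_le {p a b r : ℝ} (h : |a - b| ≤ r) : p * b - |p| * r ≤ p * a := by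
  have hmul := mul_le_mul_of_nonneg_left h (abs_nonneg p)
  rw [← abs_mul] at hmul
  linarith [neg_abs_le (p * (a - b))]

lemma tendsto_of_even_of_odd {α : Type*} {u : ℕ → α} {l : Filter α}
    (heven : Tendsto (fun k => u (2 * k)) atTop l)
    (hodd : Tendsto (fun k => u (2 * k + 1)) atTop l) : Tendsto u atTop l := by
  intro S hS
  obtain ⟨i, hi⟩ := eventually_atTop.1 (heven.eventually hS)
  obtain ⟨j, hj⟩ := eventually_atTop.1 (hodd.eventually hS)
  refine eventually_atTop.2 ⟨2 * (i + j), fun n hn => ?_⟩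
  obtain ⟨k, rfl | rfl⟩ := n.even_or_odd'
  · exact hi k (by omega)
  · exact hj k (by omega)

lemma tendsto_atTop_of_add_le_succ {u : ℕ → ℝ} {φ : ℝ → ℝ} {a : ℝ}
    (hφ : ContinuousOn φ (Set.Ioi a)) (hpos : ∀ x > a, 0 < φ x) (h0 : a < u 0)
    (hu : ∀ n, a < u n → u n + φ (u n) ≤ u (n + 1)) : Tendsto u atTop atTop := by
  have ha (n : ℕ) : a < u n := by
    induction n with
    | zero => exact h0
    | succ n ih => linarith [hu n ih, hpos _ ih]
  have hmono : Monotone u := monotone_nat_of_le_succ fun n => by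
    linarith [hu n (ha n), hpos _ (ha n)]
  refine (tendsto_atTop_of_monotone hmono).resolve_right ?_
  rintro ⟨b, hb⟩
  have hab : a < b := h0.trans_le (hmono.ge_of_tendsto hb 0)
  have hlim : b + φ b ≤ b := le_of_tendsto_of_tendsto'
    (hb.add ((hφ.continuousAt (Ioi_mem_nhds hab)).tendsto.comp hb))
    (hb.comp (tendsto_add_atTop_nat 1)) fun n => hu n (ha n)
  linarith [hpos b hab]

/-! ### Half log-odds orbits -/

/-- The larger of the two biases `|x₀ - x₁|` of a pair of strategies with half log-odds `x` and
`y`. -/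
def maxBias (x y : ℝ) : ℝ := max |tanh x| |tanh y|

lemma maxBias_rotate (x y : ℝ) : maxBias y (-x) = maxBias x y := by
  rw [maxBias, tanh_neg, abs_neg, max_comm, maxBias]

lemma maxBias_nonneg (x y : ℝ) : 0 ≤ maxBias x y :=
  (abs_nonneg _).trans (le_max_left _ _)

lemma maxBias_pos {x y : ℝ} : 0 < maxBias x y ↔ x ≠ 0 ∨ y ≠ 0 := by
  simp [maxBias, tanh_eq_sinh_div_cosh, (cosh_pos _).ne']

lemma maxBias_le_add {x y x' y' r : ℝ} (hx : |x' - x| ≤ r) (hy : |y' - y| ≤ r) :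
    maxBias x y ≤ maxBias x' y' + r := by
  have hlip {u u' : ℝ} (hu : |u' - u| ≤ r) : |tanh u| ≤ |tanh u'| + r := by
    have := abs_sub_abs_le_abs_sub (tanh u) (tanh u')
    linarith [abs_tanh_sub_tanh_le u u', abs_sub_comm u u']
  exact max_le ((hlip hx).trans (by gcongr; exact le_max_left _ _))
    ((hlip hy).trans (by gcongr; exact le_max_right _ _))

/-- The KL-divergence of the equilibrium from the pair of strategies with half log-odds `x` and
`y`. -/
def equilibriumKL (x y : ℝ) : ℝ := log (cosh x) + log (cosh y)

lemma equilibriumKL_pos {x y : ℝ} (h : x ≠ 0 ∨ y ≠ 0) : 0 < equilibriumKL x y := by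
  rcases h with h | h
  · exact add_pos_of_pos_of_nonneg (log_pos (one_lt_cosh.2 h)) (log_nonneg (one_le_cosh y))
  · exact add_pos_of_nonneg_of_pos (log_nonneg (one_le_cosh x)) (log_pos (one_lt_cosh.2 h))

lemma exp_neg_two_mul_equilibriumKL (x y : ℝ) :
    exp (-(2 * equilibriumKL x y)) = (1 - tanh x ^ 2) * (1 - tanh y ^ 2) := by
  rw [equilibriumKL, ← log_mul (cosh_pos x).ne' (cosh_pos y).ne', exp_neg, two_mul, exp_add,
    exp_log (mul_pos (cosh_pos x) (cosh_pos y)), one_sub_tanh_sq, one_sub_tanh_sq, ← mul_inv]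
  ring

/-- The second-order coefficient in `ε` of the growth of `equilibriumKL` over two steps of a
half log-odds orbit, up to a constant factor. -/
def klDrift (x y : ℝ) : ℝ := (1 - tanh x ^ 2) * tanh y ^ 2 + (1 - tanh y ^ 2) * tanh x ^ 2

lemma klDrift_nonneg (x y : ℝ) : 0 ≤ klDrift x y :=
  add_nonneg (mul_nonneg (one_sub_tanh_sq_nonneg x) (sq_nonneg _))
    (mul_nonneg (one_sub_tanh_sq_nonneg y) (sq_nonneg _))

lemma le_klDrift (x y : ℝ) :
    2 * exp (-equilibriumKL x y) * (1 - exp (-equilibriumKL x y)) ≤ klDrift x y := by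
  set P := 1 - tanh x ^ 2 with hP
  set Q := 1 - tanh y ^ 2 with hQ
  have hsq : exp (-equilibriumKL x y) ^ 2 = P * Q := by
    rw [← exp_neg_two_mul_equilibriumKL, ← exp_nat_mul]
    congr 1
    push_cast
    ring
  -- AM–GM, as `P * Q` is the square of `exp (-equilibriumKL x y)`.
  have hamgm : 2 * exp (-equilibriumKL x y) ≤ P + Q :=
    abs_le_of_sq_le_sq' (by nlinarith [sq_nonneg (P - Q)])
      (add_nonneg (one_sub_tanh_sq_nonneg x) (one_sub_tanh_sq_nonneg y)) |>.2
  have hdrift : klDrift x y = P + Q - 2 * (P * Q) := by rw [klDrift, hP, hQ]; ring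
  rw [hdrift, ← hsq]
  linarith

lemma maxBias_mul_add_le_klDrift (x y : ℝ) :
    maxBias x y * ((1 - tanh x ^ 2) * |tanh y| + (1 - tanh y ^ 2) * |tanh x|) ≤
      2 * klDrift x y := by
  wlog h : |tanh y| ≤ |tanh x| generalizing x y
  · have := this y x (le_of_not_ge h)
    simpa only [maxBias, klDrift, max_comm, add_comm] using this
  have hx := one_sub_tanh_sq_nonneg x
  have hxy : 1 - tanh x ^ 2 ≤ 1 - tanh y ^ 2 := by linarith [sq_le_sq.2 h]
  rw [maxBias, max_eq_left h]
  calc |tanh x| * ((1 - tanh x ^ 2) * |tanh y| + (1 - tanh y ^ 2) * |tanh x|)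
      ≤ |tanh x| * ((1 - tanh y ^ 2) * |tanh x| + (1 - tanh y ^ 2) * |tanh x|) := by
        gcongr
        exact hx.trans hxy
    _ = 2 * ((1 - tanh y ^ 2) * tanh x ^ 2) := by rw [← sq_abs (tanh x)]; ring
    _ ≤ 2 * klDrift x y := by
      rw [klDrift]
      linarith [mul_nonneg hx (sq_nonneg (tanh y))]

/-- The dynamics of Optimistic MWU with step size `2 * ε` in the 2-periodic game, `X n` and `Y n`
being the half log-odds of the two players at time `n`. The game alternates, `-A_{t-1} = A_t`, so
the correction term of a step has the same sign as the main term. -/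
structure IsLogOddsOrbit (ε : ℝ) (X Y : ℕ → ℝ) : Prop where
  fst_step : ∀ n, X (n + 2) =
    X (n + 1) - (-1) ^ n * (ε * (2 * tanh (Y (n + 1)) + tanh (Y n)))
  snd_step : ∀ n, Y (n + 2) =
    Y (n + 1) + (-1) ^ n * (ε * (2 * tanh (X (n + 1)) + tanh (X n)))

namespace IsLogOddsOrbit

variable {ε : ℝ} {X Y : ℕ → ℝ}

lemma rotate (h : IsLogOddsOrbit ε X Y) : IsLogOddsOrbit ε Y (fun n => -X n) where
  fst_step n := by rw [h.snd_step, tanh_neg, tanh_neg]; ring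
  snd_step n := by rw [h.fst_step]; ring

lemma abs_snd_step_le (h : IsLogOddsOrbit ε X Y) (hε : 0 ≤ ε) (n : ℕ) :
    |Y (n + 2) - Y (n + 1)| ≤
      ε * (2 * maxBias (X (n + 1)) (Y (n + 1)) + maxBias (X n) (Y n)) := by
  rw [h.snd_step, add_sub_cancel_left, abs_mul, abs_neg_one_pow, one_mul, abs_mul,
    abs_of_nonneg hε]
  gcongr
  refine (abs_add_le _ _).trans (add_le_add ?_ (le_max_left _ _))
  rw [abs_mul, abs_two]
  gcongr
  exact le_max_left _ _

lemma abs_fst_step_le (h : IsLogOddsOrbit ε X Y) (hε : 0 ≤ ε) (n : ℕ) :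
    |X (n + 2) - X (n + 1)| ≤
      ε * (2 * maxBias (X (n + 1)) (Y (n + 1)) + maxBias (X n) (Y n)) := by
  have := h.rotate.abs_snd_step_le hε n
  rwa [maxBias_rotate, maxBias_rotate, neg_sub_neg, abs_sub_comm] at this

lemma maxBias_le_three_mul_succ (h : IsLogOddsOrbit ε X Y) (hε : 0 ≤ ε) (hε' : ε ≤ 1 / 10)
    (h0 : maxBias (X 0) (Y 0) ≤ 3 * maxBias (X 1) (Y 1)) (n : ℕ) :
    maxBias (X n) (Y n) ≤ 3 * maxBias (X (n + 1)) (Y (n + 1)) := by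
  induction n with
  | zero => exact h0
  | succ n ih =>
    have := maxBias_le_add (h.abs_fst_step_le hε n) (h.abs_snd_step_le hε n)
    have := maxBias_nonneg (X (n + 1)) (Y (n + 1))
    have hstep : ε * (2 * maxBias (X (n + 1)) (Y (n + 1)) + maxBias (X n) (Y n)) ≤
        1 / 10 * (5 * maxBias (X (n + 1)) (Y (n + 1))) := by
      have := maxBias_nonneg (X n) (Y n)
      gcongr
      linarith
    linarith

lemma abs_snd_two_step_sub_le (h : IsLogOddsOrbit ε X Y) (hε : 0 ≤ ε) (hε' : ε ≤ 1 / 6) (n : ℕ) :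
    |Y (n + 5) - Y (n + 3) -
        ε ^ 2 * (1 - tanh (X (n + 3)) ^ 2) * (4 * tanh (Y (n + 3)) - tanh (Y (n + 1)))| ≤
      2 * ε ^ 3 * (1 - tanh (X (n + 3)) ^ 2) *
        (2 * (2 * tanh (Y (n + 3)) + tanh (Y (n + 2))) ^ 2 +
          (2 * tanh (Y (n + 2)) + tanh (Y (n + 1))) ^ 2) := by
  set σ : ℝ := -(-1) ^ n with hσ
  set c := 1 - tanh (X (n + 3)) ^ 2 with hc
  set d := 2 * tanh (Y (n + 3)) + tanh (Y (n + 2)) with hd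
  set e := 2 * tanh (Y (n + 2)) + tanh (Y (n + 1)) with he
  have hσ1 : |σ| = 1 := by rw [hσ, abs_neg, abs_neg_one_pow]
  have hX4 : X (n + 4) = X (n + 3) + σ * (ε * d) := by rw [hd, hσ, h.fst_step (n + 2)]; ring
  have hX2 : X (n + 2) = X (n + 3) + σ * (ε * e) := by rw [he, hσ, h.fst_step (n + 1)]; ring
  have hY : Y (n + 5) - Y (n + 3) = ε * (2 * (σ * (tanh (X (n + 4)) - tanh (X (n + 3)))) -
      σ * (tanh (X (n + 2)) - tanh (X (n + 3)))) := by
    rw [hσ, h.snd_step (n + 3), h.snd_step (n + 2)]; ring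
  have hsmall (u v : ℝ) : |ε * (2 * tanh u + tanh v)| ≤ 1 / 2 := by
    rw [abs_mul, abs_of_nonneg hε]
    calc ε * |2 * tanh u + tanh v| ≤ 1 / 6 * 3 := by gcongr; exact abs_two_mul_tanh_add_tanh_le u v
      _ = 1 / 2 := by norm_num
  have htaylor4 := abs_sign_mul_tanh_add_sub_tanh_sub_le hσ1 (X (n + 3))
    (hsmall (Y (n + 3)) (Y (n + 2)))
  have htaylor2 := abs_sign_mul_tanh_add_sub_tanh_sub_le hσ1 (X (n + 3))
    (hsmall (Y (n + 2)) (Y (n + 1)))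
  rw [← hd, ← hX4, ← hc] at htaylor4
  rw [← he, ← hX2, ← hc] at htaylor2
  set r4 := σ * (tanh (X (n + 4)) - tanh (X (n + 3))) - c * (ε * d) with hr4
  set r2 := σ * (tanh (X (n + 2)) - tanh (X (n + 3))) - c * (ε * e) with hr2
  have hmain : Y (n + 5) - Y (n + 3) - ε ^ 2 * c * (4 * tanh (Y (n + 3)) - tanh (Y (n + 1))) =
      ε * (2 * r4 - r2) := by rw [hY, hr4, hr2, hd, he]; ring
  calc |Y (n + 5) - Y (n + 3) - ε ^ 2 * c * (4 * tanh (Y (n + 3)) - tanh (Y (n + 1)))|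
      = ε * |2 * r4 - r2| := by rw [hmain, abs_mul, abs_of_nonneg hε]
    _ ≤ ε * (|2 * r4| + |r2|) := by gcongr; exact abs_sub _ _
    _ = ε * (2 * |r4| + |r2|) := by rw [abs_mul, abs_two]
    _ ≤ ε * (2 * (2 * c * (ε * d) ^ 2) + 2 * c * (ε * e) ^ 2) := by gcongr
    _ = 2 * ε ^ 3 * c * (2 * d ^ 2 + e ^ 2) := by ring

lemma abs_tanh_snd_succ_sub_le (h : IsLogOddsOrbit ε X Y) (hε : 0 ≤ ε) (hε' : ε ≤ 1 / 10)
    (h0 : maxBias (X 0) (Y 0) ≤ 3 * maxBias (X 1) (Y 1)) (n : ℕ) :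
    |tanh (Y (n + 2)) - tanh (Y (n + 1))| ≤ 5 * ε * maxBias (X (n + 1)) (Y (n + 1)) :=
  calc |tanh (Y (n + 2)) - tanh (Y (n + 1))|
      ≤ |Y (n + 2) - Y (n + 1)| := abs_tanh_sub_tanh_le _ _
    _ ≤ ε * (2 * maxBias (X (n + 1)) (Y (n + 1)) + maxBias (X n) (Y n)) := h.abs_snd_step_le hε n
    _ ≤ ε * (2 * maxBias (X (n + 1)) (Y (n + 1)) + 3 * maxBias (X (n + 1)) (Y (n + 1))) := by
      gcongr
      exact h.maxBias_le_three_mul_succ hε hε' h0 n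
    _ = 5 * ε * maxBias (X (n + 1)) (Y (n + 1)) := by ring

lemma sq_two_mul_tanh_snd_add_le (h : IsLogOddsOrbit ε X Y) (hε : 0 ≤ ε) (hε' : ε ≤ 1 / 10)
    (h0 : maxBias (X 0) (Y 0) ≤ 3 * maxBias (X 1) (Y 1)) (n : ℕ) :
    (2 * tanh (Y (n + 1)) + tanh (Y n)) ^ 2 ≤ 15 * maxBias (X (n + 1)) (Y (n + 1)) := by
  have hle : |2 * tanh (Y (n + 1)) + tanh (Y n)| ≤ 5 * maxBias (X (n + 1)) (Y (n + 1)) := by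
    have hsucc : |tanh (Y (n + 1))| ≤ maxBias (X (n + 1)) (Y (n + 1)) := le_max_right _ _
    have hself : |tanh (Y n)| ≤ maxBias (X n) (Y n) := le_max_right _ _
    have hadd := abs_add_le (2 * tanh (Y (n + 1))) (tanh (Y n))
    rw [abs_mul, abs_two] at hadd
    linarith [h.maxBias_le_three_mul_succ hε hε' h0 n]
  rw [← sq_abs, sq]
  calc |2 * tanh (Y (n + 1)) + tanh (Y n)| * |2 * tanh (Y (n + 1)) + tanh (Y n)|
      ≤ 3 * (5 * maxBias (X (n + 1)) (Y (n + 1))) := by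
        gcongr
        exact abs_two_mul_tanh_add_tanh_le _ _
    _ = 15 * maxBias (X (n + 1)) (Y (n + 1)) := by ring

lemma abs_snd_two_step_sub_three_mul_le (h : IsLogOddsOrbit ε X Y) (hε : 0 ≤ ε) (hε' : ε ≤ 1 / 10)
    (h0 : maxBias (X 0) (Y 0) ≤ 3 * maxBias (X 1) (Y 1)) (n : ℕ) :
    |Y (n + 5) - Y (n + 3) - 3 * ε ^ 2 * ((1 - tanh (X (n + 3)) ^ 2) * tanh (Y (n + 3)))| ≤
      210 * ε ^ 3 * ((1 - tanh (X (n + 3)) ^ 2) * maxBias (X (n + 3)) (Y (n + 3))) := by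
  set m := maxBias (X (n + 3)) (Y (n + 3))
  set c := 1 - tanh (X (n + 3)) ^ 2
  set q₁ := tanh (Y (n + 1))
  set q₂ := tanh (Y (n + 2))
  set q₃ := tanh (Y (n + 3))
  have hc : 0 ≤ c := one_sub_tanh_sq_nonneg _
  have hm₂ : maxBias (X (n + 2)) (Y (n + 2)) ≤ 3 * m := h.maxBias_le_three_mul_succ hε hε' h0 _
  have hm₁ : maxBias (X (n + 1)) (Y (n + 1)) ≤ 9 * m := by
    linarith [h.maxBias_le_three_mul_succ hε hε' h0 (n + 1)]
  have hq : |q₃ - q₁| ≤ 60 * ε * m :=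
    calc |q₃ - q₁| ≤ |q₃ - q₂| + |q₂ - q₁| := abs_sub_le _ _ _
      _ ≤ 5 * ε * maxBias (X (n + 2)) (Y (n + 2)) + 5 * ε * maxBias (X (n + 1)) (Y (n + 1)) :=
        add_le_add (h.abs_tanh_snd_succ_sub_le hε hε' h0 (n + 1))
          (h.abs_tanh_snd_succ_sub_le hε hε' h0 n)
      _ ≤ 5 * ε * (3 * m) + 5 * ε * (9 * m) := by gcongr
      _ = 60 * ε * m := by ring
  have hsq : 2 * (2 * q₃ + q₂) ^ 2 + (2 * q₂ + q₁) ^ 2 ≤ 75 * m := by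
    linarith [h.sq_two_mul_tanh_snd_add_le hε hε' h0 (n + 2),
      h.sq_two_mul_tanh_snd_add_le hε hε' h0 (n + 1)]
  calc |Y (n + 5) - Y (n + 3) - 3 * ε ^ 2 * (c * q₃)|
      = |(Y (n + 5) - Y (n + 3) - ε ^ 2 * c * (4 * q₃ - q₁)) + ε ^ 2 * c * (q₃ - q₁)| := by
        congr 1; ring
    _ ≤ |Y (n + 5) - Y (n + 3) - ε ^ 2 * c * (4 * q₃ - q₁)| + ε ^ 2 * c * |q₃ - q₁| := by
        refine (abs_add_le _ _).trans_eq ?_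
        rw [abs_mul (ε ^ 2 * c), abs_of_nonneg (by positivity : 0 ≤ ε ^ 2 * c)]
    _ ≤ 2 * ε ^ 3 * c * (2 * (2 * q₃ + q₂) ^ 2 + (2 * q₂ + q₁) ^ 2) +
          ε ^ 2 * c * |q₃ - q₁| := by
        gcongr
        exact h.abs_snd_two_step_sub_le hε (by linarith) n
    _ ≤ 2 * ε ^ 3 * c * (75 * m) + ε ^ 2 * c * (60 * ε * m) := by gcongr
    _ = 210 * ε ^ 3 * (c * m) := by ring

lemma abs_fst_two_step_sub_three_mul_le (h : IsLogOddsOrbit ε X Y) (hε : 0 ≤ ε) (hε' : ε ≤ 1 / 10)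
    (h0 : maxBias (X 0) (Y 0) ≤ 3 * maxBias (X 1) (Y 1)) (n : ℕ) :
    |X (n + 5) - X (n + 3) - 3 * ε ^ 2 * ((1 - tanh (Y (n + 3)) ^ 2) * tanh (X (n + 3)))| ≤
      210 * ε ^ 3 * ((1 - tanh (Y (n + 3)) ^ 2) * maxBias (X (n + 3)) (Y (n + 3))) := by
  have hrot := h.rotate.abs_snd_two_step_sub_three_mul_le hε hε'
    (by rwa [maxBias_rotate, maxBias_rotate]) n
  rw [maxBias_rotate, tanh_neg, ← abs_neg] at hrot
  convert hrot using 2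
  ring

lemma equilibriumKL_add_sq_mul_klDrift_le (h : IsLogOddsOrbit ε X Y) (hε : 0 ≤ ε)
    (hε' : ε ≤ 1 / 210) (h0 : maxBias (X 0) (Y 0) ≤ 3 * maxBias (X 1) (Y 1)) (n : ℕ) :
    equilibriumKL (X (n + 3)) (Y (n + 3)) + ε ^ 2 * klDrift (X (n + 3)) (Y (n + 3)) ≤
      equilibriumKL (X (n + 5)) (Y (n + 5)) := by
  set x := X (n + 3)
  set y := Y (n + 3)
  have hX := mul_sub_abs_mul_le (p := tanh x)
    (h.abs_fst_two_step_sub_three_mul_le hε (by linarith) h0 n)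
  have hY := mul_sub_abs_mul_le (p := tanh y)
    (h.abs_snd_two_step_sub_three_mul_le hε (by linarith) h0 n)
  have hdrift := klDrift_nonneg x y
  have htangent := add_le_add (tanh_mul_sub_le_log_cosh_sub x (X (n + 5)))
    (tanh_mul_sub_le_log_cosh_sub y (Y (n + 5)))
  have herror : ε ^ 3 * (2 * klDrift x y) ≤ ε ^ 2 * (1 / 210) * (2 * klDrift x y) := by
    rw [pow_succ]
    gcongr
  calc equilibriumKL x y + ε ^ 2 * klDrift x y
      ≤ equilibriumKL x y + 3 * ε ^ 2 * klDrift x y - 210 * ε ^ 3 * (2 * klDrift x y) := by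
        linarith
    _ ≤ equilibriumKL x y + 3 * ε ^ 2 * klDrift x y - 210 * ε ^ 3 * (maxBias x y *
          ((1 - tanh x ^ 2) * |tanh y| + (1 - tanh y ^ 2) * |tanh x|)) :=
        sub_le_sub_left (mul_le_mul_of_nonneg_left (maxBias_mul_add_le_klDrift x y)
          (by positivity)) _
    _ ≤ equilibriumKL x y + (tanh x * (X (n + 5) - x) + tanh y * (Y (n + 5) - y)) := by
        rw [klDrift]
        linarith
    _ ≤ equilibriumKL (X (n + 5)) (Y (n + 5)) := by
        rw [equilibriumKL, equilibriumKL]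
        linarith

lemma ne_zero (h : IsLogOddsOrbit ε X Y) (hε : 0 ≤ ε) (hε' : ε ≤ 1 / 10)
    (h0 : maxBias (X 0) (Y 0) ≤ 3 * maxBias (X 1) (Y 1)) (hne : X 0 ≠ 0 ∨ Y 0 ≠ 0) (n : ℕ) :
    X n ≠ 0 ∨ Y n ≠ 0 := by
  induction n with
  | zero => exact hne
  | succ n ih =>
    rw [← maxBias_pos] at ih ⊢
    linarith [h.maxBias_le_three_mul_succ hε hε' h0 n]

theorem tendsto_equilibriumKL (h : IsLogOddsOrbit ε X Y) (hε : 0 < ε) (hε' : ε ≤ 1 / 210)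
    (h0 : maxBias (X 0) (Y 0) ≤ 3 * maxBias (X 1) (Y 1)) (hne : X 0 ≠ 0 ∨ Y 0 ≠ 0) :
    Tendsto (fun n => equilibriumKL (X n) (Y n)) atTop atTop := by
  set φ : ℝ → ℝ := fun L => ε ^ 2 * (2 * exp (-L) * (1 - exp (-L)))
  have hφcont : Continuous φ := by fun_prop
  have hφpos (L : ℝ) (hL : 0 < L) : 0 < φ L := by
    have : 0 < 1 - exp (-L) := sub_pos.2 (exp_lt_one_iff.2 (neg_lt_zero.2 hL))
    positivity
  have hgrow (n : ℕ) : equilibriumKL (X (n + 3)) (Y (n + 3)) +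
      φ (equilibriumKL (X (n + 3)) (Y (n + 3))) ≤ equilibriumKL (X (n + 5)) (Y (n + 5)) := by
    refine le_trans ?_ (h.equilibriumKL_add_sq_mul_klDrift_le hε.le hε' h0 n)
    exact add_le_add_right (mul_le_mul_of_nonneg_left (le_klDrift _ _) (sq_nonneg ε)) _
  have hpos (n : ℕ) : 0 < equilibriumKL (X n) (Y n) :=
    equilibriumKL_pos (h.ne_zero hε.le (by linarith) h0 hne n)
  refine (tendsto_add_atTop_iff_nat 3).1 (tendsto_of_even_of_odd ?_ ?_)
  · exact tendsto_atTop_of_add_le_succ hφcont.continuousOn hφpos (hpos _) fun k _ => hgrow (2 * k)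
  · exact tendsto_atTop_of_add_le_succ hφcont.continuousOn hφpos (hpos _)
      fun k _ => hgrow (2 * k + 1)

end IsLogOddsOrbit

/-! ### Optimistic multiplicative weights -/

/-- A strategy in the interior of the simplex: a probability vector with full support. -/
def IsFullyMixed {n : ℕ} (x : Fin n → ℝ) : Prop :=
  x ∈ stdSimplex ℝ (Fin n) ∧ ∀ i, 0 < x i

lemma isFullyMixed_of_ne_zero {n : ℕ} {x : Fin n → ℝ} (hx : x ∈ stdSimplex ℝ (Fin n))
    (h : ∀ i, x i ≠ 0) : IsFullyMixed x :=
  ⟨hx, fun i => (hx.1 i).lt_of_ne' (h i)⟩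

lemma isFullyMixed_mwUpdate {n : ℕ} {x : Fin n → ℝ} (hx : IsFullyMixed x) (g : Fin n → ℝ) :
    IsFullyMixed (mwUpdate x g) := by
  have hsum : 0 < ∑ s, x s * exp (g s) :=
    Finset.sum_pos (fun s _ => mul_pos (hx.2 s) (exp_pos _))
      (Finset.nonempty_of_sum_ne_zero (hx.1.2 ▸ one_ne_zero))
  have hpos (i : Fin n) : 0 < mwUpdate x g i := div_pos (mul_pos (hx.2 i) (exp_pos _)) hsum
  refine ⟨⟨fun i => (hpos i).le, ?_⟩, hpos⟩
  simp only [mwUpdate]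
  rw [← Finset.sum_div, div_self hsum.ne']

section Trajectories

variable {m n : ℕ} {η : ℝ} {A : ℤ → Matrix (Fin m) (Fin n) ℝ} {zm z0 : Profile m n}

lemma omwu_add_two (t : ℕ) : omwu η A zm z0 (t + 2) =
    omwuStep η (A ((t + 1 : ℕ) - 1)) (A (t + 1 : ℕ)) (omwu η A zm z0 t) (omwu η A zm z0 (t + 1)) :=
  rfl

lemma isFullyMixed_omwu (h₁ : IsFullyMixed z0.1) (h₂ : IsFullyMixed z0.2) (t : ℕ) :
    IsFullyMixed (omwu η A zm z0 t).1 ∧ IsFullyMixed (omwu η A zm z0 t).2 := by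
  induction t with
  | zero => exact ⟨h₁, h₂⟩
  | succ t ih => exact ⟨isFullyMixed_mwUpdate ih.1 _, isFullyMixed_mwUpdate ih.2 _⟩

lemma mwUpdate_eq_zero {x : Fin n → ℝ} {i : Fin n} (h : x i = 0) (g : Fin n → ℝ) :
    mwUpdate x g i = 0 := by
  rw [mwUpdate, h, zero_mul, zero_div]

lemma omwu_fst_eq_zero {i : Fin m} (h : z0.1 i = 0) (t : ℕ) : (omwu η A zm z0 t).1 i = 0 := by
  induction t with
  | zero => exact h
  | succ t ih => exact mwUpdate_eq_zero ih _

lemma omwu_snd_eq_zero {i : Fin n} (h : z0.2 i = 0) (t : ℕ) : (omwu η A zm z0 t).2 i = 0 := by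
  induction t with
  | zero => exact h
  | succ t ih => exact mwUpdate_eq_zero ih _

end Trajectories

/-- Half the log-odds of the first action against the second, so that `tanh` recovers the bias
`x 0 - x 1`. -/
def halfLogOdds (x : Fin 2 → ℝ) : ℝ := log (x 0 / x 1) / 2

lemma halfLogOdds_mwUpdate {x : Fin 2 → ℝ} (hx : ∀ i, 0 < x i) (g : Fin 2 → ℝ) :
    halfLogOdds (mwUpdate x g) = halfLogOdds x + (g 0 - g 1) / 2 := by
  have h0 := hx 0
  have h1 := hx 1
  have hratio : mwUpdate x g 0 / mwUpdate x g 1 = x 0 / x 1 * exp (g 0 - g 1) := by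
    have : 0 < x 0 * exp (g 0) + x 1 * exp (g 1) := by positivity
    simp only [mwUpdate, Fin.sum_univ_two, exp_sub]
    field_simp
  rw [halfLogOdds, hratio, log_mul (by positivity) (exp_ne_zero _), log_exp, halfLogOdds]
  ring

lemma IsFullyMixed.tanh_halfLogOdds {x : Fin 2 → ℝ} (hx : IsFullyMixed x) :
    tanh (halfLogOdds x) = x 0 - x 1 := by
  have h0 := hx.2 0
  have h1 := hx.2 1
  have hsum : x 0 + x 1 = 1 := by simpa using hx.1.2
  have hexp : exp (halfLogOdds x) ^ 2 = x 0 / x 1 := by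
    rw [← exp_nat_mul, halfLogOdds, Nat.cast_ofNat, mul_div_cancel₀ _ two_ne_zero,
      exp_log (by positivity)]
  have := exp_pos (halfLogOdds x)
  calc tanh (halfLogOdds x)
      = (exp (halfLogOdds x) ^ 2 - 1) / (exp (halfLogOdds x) ^ 2 + 1) := by
        rw [tanh_eq, exp_neg]
        field_simp
    _ = (x 0 - x 1) / (x 0 + x 1) := by rw [hexp]; field_simp
    _ = x 0 - x 1 := by rw [hsum, div_one]

lemma IsFullyMixed.klVec_uniform {x : Fin 2 → ℝ} (hx : IsFullyMixed x) :
    klVec ![1 / 2, 1 / 2] x = ((log (cosh (halfLogOdds x)) : ℝ) : EReal) := by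
  have h0 := hx.2 0
  have h1 := hx.2 1
  have hsum : x 0 + x 1 = 1 := by simpa using hx.1.2
  have hcosh : (cosh (halfLogOdds x) ^ 2)⁻¹ = 2 * x 0 * (2 * x 1) := by
    rw [← one_sub_tanh_sq, hx.tanh_halfLogOdds]
    linear_combination (x 0 + x 1 + 1) * (-hsum)
  have hlog := congrArg log hcosh
  rw [log_inv, log_pow, log_mul (by positivity) (by positivity)] at hlog
  rw [klVec, if_neg fun ⟨i, _, hi⟩ => (hx.2 i).ne' hi, EReal.coe_eq_coe_iff, Fin.sum_univ_two]
  simp only [Matrix.cons_val_zero, Matrix.cons_val_one, div_div]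
  rw [one_div (2 * x 0), one_div (2 * x 1), log_inv, log_inv]
  push_cast at hlog
  linarith

lemma klProfile_equilibrium_of_isFullyMixed {z : Profile 2 2} (h₁ : IsFullyMixed z.1)
    (h₂ : IsFullyMixed z.2) : klProfile equilibrium z =
      ((equilibriumKL (halfLogOdds z.1) (halfLogOdds z.2) : ℝ) : EReal) := by
  rw [klProfile, equilibrium, h₁.klVec_uniform, h₂.klVec_uniform, ← EReal.coe_add, equilibriumKL]

lemma klVec_ne_bot {n : ℕ} (p q : Fin n → ℝ) : klVec p q ≠ ⊥ := by
  unfold klVec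
  split_ifs
  · exact top_ne_bot
  · exact EReal.coe_ne_bot _

lemma klVec_eq_top {n : ℕ} {p q : Fin n → ℝ} {i : Fin n} (hp : p i ≠ 0) (hq : q i = 0) :
    klVec p q = ⊤ := if_pos ⟨i, hp, hq⟩

lemma klProfile_eq_top {m n : ℕ} {w z : Profile m n}
    (h : (∃ i, w.1 i ≠ 0 ∧ z.1 i = 0) ∨ ∃ i, w.2 i ≠ 0 ∧ z.2 i = 0) : klProfile w z = ⊤ := by
  rcases h with ⟨i, hw, hz⟩ | ⟨i, hw, hz⟩
  · rw [klProfile, klVec_eq_top hw hz, EReal.top_add_of_ne_bot (klVec_ne_bot _ _)]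
  · rw [klProfile, klVec_eq_top hw hz, EReal.add_top_of_ne_bot (klVec_ne_bot _ _)]

lemma tendsto_klVec_self {n : ℕ} {p : Fin n → ℝ} (hp : ∀ i, p i ≠ 0) :
    Tendsto (klVec p) (𝓝 p) (𝓝 0) := by
  have hcont : ContinuousAt (fun q : Fin n → ℝ => ∑ i, p i * log (p i / q i)) p := by
    refine tendsto_finsetSum _ fun i _ => ?_
    exact continuousAt_const.mul ((continuousAt_const.div (continuousAt_apply i p) (hp i)).log
      (div_ne_zero (hp i) (hp i)))
  have hzero : ∑ i, p i * log (p i / p i) = 0 :=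
    Finset.sum_eq_zero fun i _ => by rw [div_self (hp i), log_one, mul_zero]
  have hreal := (continuous_coe_real_ereal.tendsto _).comp hcont.tendsto
  rw [hzero, EReal.coe_zero] at hreal
  refine hreal.congr' ?_
  filter_upwards [eventually_all.2 fun i => (continuousAt_apply i p).eventually_ne (hp i)] with q hq
  exact (if_neg fun ⟨i, _, hi⟩ => hq i hi).symm

lemma tendsto_klProfile_self {m n : ℕ} {w : Profile m n} (h₁ : ∀ i, w.1 i ≠ 0)
    (h₂ : ∀ i, w.2 i ≠ 0) : Tendsto (klProfile w) (𝓝 w) (𝓝 0) := by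
  have hadd : Tendsto (fun p : EReal × EReal => p.1 + p.2) (𝓝 (0, 0)) (𝓝 (0 + 0)) :=
    EReal.continuousAt_add (by simp) (by simp)
  rw [add_zero] at hadd
  exact hadd.comp (((tendsto_klVec_self h₁).comp continuousAt_fst).prodMk_nhds
    ((tendsto_klVec_self h₂).comp continuousAt_snd))

lemma equilibrium_fst_ne_zero (i : Fin 2) : equilibrium.1 i ≠ 0 := by
  fin_cases i <;> norm_num [equilibrium]

lemma equilibrium_snd_ne_zero (i : Fin 2) : equilibrium.2 i ≠ 0 :=
  equilibrium_fst_ne_zero i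

lemma not_tendsto_of_tendsto_klProfile_top {m n : ℕ} {w : Profile m n} (h₁ : ∀ i, w.1 i ≠ 0)
    (h₂ : ∀ i, w.2 i ≠ 0) {z : ℕ → Profile m n}
    (h : Tendsto (fun t => klProfile w (z t)) atTop (𝓝 ⊤)) : ¬ Tendsto z atTop (𝓝 w) := fun hz =>
  EReal.top_ne_zero (tendsto_nhds_unique h ((tendsto_klProfile_self h₁ h₂).comp hz))

lemma periodicGame_transpose (t : ℤ) : (periodicGame t).transpose = periodicGame t := by
  unfold periodicGame
  split_ifs <;> ext i j <;> fin_cases i <;> fin_cases j <;> rfl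

lemma periodicGame_mulVec_sub (t : ℤ) (v : Fin 2 → ℝ) :
    (periodicGame t).mulVec v 0 - (periodicGame t).mulVec v 1 = (-1) ^ t * (v 0 - v 1) := by
  rcases t.even_or_odd with ht | ht
  · rw [periodicGame, if_neg (Int.not_odd_iff_even.2 ht), ht.neg_one_zpow]
    simp [Matrix.mulVec, dotProduct, Fin.sum_univ_two, neg_add_eq_sub]
  · rw [periodicGame, if_pos ht, ht.neg_one_zpow]
    simp [Matrix.mulVec, dotProduct, Fin.sum_univ_two]

lemma periodicGame_extrapolation_sub (η : ℝ) (t : ℤ) (v v' : Fin 2 → ℝ) :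
    ((2 * η) • (periodicGame t).mulVec v - η • (periodicGame (t - 1)).mulVec v') 0 -
      ((2 * η) • (periodicGame t).mulVec v - η • (periodicGame (t - 1)).mulVec v') 1 =
      (-1) ^ t * (η * (2 * (v 0 - v 1) + (v' 0 - v' 1))) := by
  have hnow := periodicGame_mulVec_sub t v
  have hprev := periodicGame_mulVec_sub (t - 1) v'
  rw [zpow_sub_one₀ (by norm_num), inv_neg_one] at hprev
  simp only [Pi.sub_apply, Pi.smul_apply, smul_eq_mul]
  linear_combination 2 * η * hnow - η * hprev

lemma halfLogOdds_omwuStep_fst (η : ℝ) (t : ℤ) (z' : Profile 2 2) {z : Profile 2 2}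
    (hz : ∀ i, 0 < z.1 i) :
    halfLogOdds (omwuStep η (periodicGame (t - 1)) (periodicGame t) z' z).1 =
      halfLogOdds z.1 + (-1) ^ t * (η / 2 * (2 * (z.2 0 - z.2 1) + (z'.2 0 - z'.2 1))) := by
  rw [omwuStep, halfLogOdds_mwUpdate hz, periodicGame_extrapolation_sub]
  ring

lemma halfLogOdds_omwuStep_snd (η : ℝ) (t : ℤ) (z' : Profile 2 2) {z : Profile 2 2}
    (hz : ∀ i, 0 < z.2 i) :
    halfLogOdds (omwuStep η (periodicGame (t - 1)) (periodicGame t) z' z).2 =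
      halfLogOdds z.2 - (-1) ^ t * (η / 2 * (2 * (z.1 0 - z.1 1) + (z'.1 0 - z'.1 1))) := by
  rw [omwuStep, halfLogOdds_mwUpdate hz, periodicGame_transpose, periodicGame_transpose,
    Pi.neg_apply, Pi.neg_apply, neg_sub_neg, ← neg_sub, periodicGame_extrapolation_sub]
  ring

lemma isLogOddsOrbit_omwu {η : ℝ} {zm z0 : Profile 2 2} (h₁ : IsFullyMixed z0.1)
    (h₂ : IsFullyMixed z0.2) :
    IsLogOddsOrbit (η / 2) (fun t => halfLogOdds (omwu η periodicGame zm z0 t).1)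
      (fun t => halfLogOdds (omwu η periodicGame zm z0 t).2) := by
  have hmixed (t : ℕ) := isFullyMixed_omwu (η := η) (A := periodicGame) (zm := zm) h₁ h₂ t
  constructor <;> intro t
  · rw [(hmixed (t + 1)).2.tanh_halfLogOdds, (hmixed t).2.tanh_halfLogOdds, omwu_add_two,
      halfLogOdds_omwuStep_fst η _ _ (hmixed (t + 1)).1.2, zpow_natCast]
    ring
  · rw [(hmixed (t + 1)).1.tanh_halfLogOdds, (hmixed t).1.tanh_halfLogOdds, omwu_add_two,
      halfLogOdds_omwuStep_snd η _ _ (hmixed (t + 1)).2.2, zpow_natCast]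
    ring

lemma dist_uniform_of_mem_stdSimplex {x : Fin 2 → ℝ} (hx : x ∈ stdSimplex ℝ (Fin 2)) :
    dist x ![1 / 2, 1 / 2] = |x 0 - 1 / 2| := by
  have hsum : x 0 + x 1 = 1 := by simpa using hx.2
  refine le_antisymm ((dist_pi_le_iff (abs_nonneg _)).2 fun i => ?_)
    (dist_le_pi_dist x ![1 / 2, 1 / 2] 0)
  fin_cases i
  · rfl
  · change |x 1 - 1 / 2| ≤ _
    rw [← abs_neg]
    exact (congrArg _ (by linarith)).le

lemma dist_equilibrium_of_mem {z : Profile 2 2} (hz : z ∈ mixedProfiles 2 2) :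
    dist z equilibrium =
      max |z.1 0 - equilibrium.1 0| |z.2 0 - equilibrium.2 0| :=
  congrArg₂ max (dist_uniform_of_mem_stdSimplex hz.1) (dist_uniform_of_mem_stdSimplex hz.2)

lemma abs_sub_le_two_mul_dist_uniform (x : Fin 2 → ℝ) :
    |x 0 - x 1| ≤ 2 * dist x ![1 / 2, 1 / 2] := by
  have h0 : |x 0 - 1 / 2| ≤ dist x ![1 / 2, 1 / 2] := dist_le_pi_dist x ![1 / 2, 1 / 2] 0
  have h1 : |x 1 - 1 / 2| ≤ dist x ![1 / 2, 1 / 2] := dist_le_pi_dist x ![1 / 2, 1 / 2] 1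
  linarith [abs_sub_le (x 0) (1 / 2) (x 1), abs_sub_comm (x 1) (1 / 2)]

lemma IsFullyMixed.abs_tanh_halfLogOdds {x : Fin 2 → ℝ} (hx : IsFullyMixed x) :
    |tanh (halfLogOdds x)| = 2 * dist x ![1 / 2, 1 / 2] := by
  have hsum : x 0 + x 1 = 1 := by simpa using hx.1.2
  rw [hx.tanh_halfLogOdds, dist_uniform_of_mem_stdSimplex hx.1, ← abs_two, ← abs_mul, abs_two]
  congr 1
  linarith

lemma maxBias_halfLogOdds {z : Profile 2 2} (h₁ : IsFullyMixed z.1) (h₂ : IsFullyMixed z.2) :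
    maxBias (halfLogOdds z.1) (halfLogOdds z.2) = 2 * dist z equilibrium := by
  rw [maxBias, h₁.abs_tanh_halfLogOdds, h₂.abs_tanh_halfLogOdds,
    ← mul_max_of_nonneg _ _ zero_le_two]
  rfl

lemma halfLogOdds_ne_zero_of_ne_equilibrium {z : Profile 2 2} (h₁ : IsFullyMixed z.1)
    (h₂ : IsFullyMixed z.2) (hz : z ≠ equilibrium) :
    halfLogOdds z.1 ≠ 0 ∨ halfLogOdds z.2 ≠ 0 := by
  rw [← maxBias_pos, maxBias_halfLogOdds h₁ h₂]
  exact mul_pos two_pos (dist_pos.2 hz)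

lemma dist_equilibrium_le_half {z : Profile 2 2} (hz : z ∈ mixedProfiles 2 2) :
    dist z equilibrium ≤ 1 / 2 := by
  have hvec {x : Fin 2 → ℝ} (hx : x ∈ stdSimplex ℝ (Fin 2)) : dist x ![1 / 2, 1 / 2] ≤ 1 / 2 := by
    rw [dist_uniform_of_mem_stdSimplex hx, abs_le]
    constructor <;> linarith [hx.1 0, (mem_Icc_of_mem_stdSimplex hx 0).2]
  exact max_le (hvec hz.1) (hvec hz.2)

lemma abs_half_mul_extrapolation_le {η : ℝ} (hη : 0 ≤ η) (t : ℤ) {x x' : Fin 2 → ℝ} {d d' : ℝ}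
    (hx : dist x ![1 / 2, 1 / 2] ≤ d) (hx' : dist x' ![1 / 2, 1 / 2] ≤ d') :
    |(-1) ^ t * (η / 2 * (2 * (x 0 - x 1) + (x' 0 - x' 1)))| ≤ η * (2 * d + d') := by
  rw [abs_mul, abs_zpow, abs_neg, abs_one, one_zpow, one_mul, abs_mul,
    abs_of_nonneg (by positivity)]
  calc η / 2 * |2 * (x 0 - x 1) + (x' 0 - x' 1)|
      ≤ η / 2 * (2 * |x 0 - x 1| + |x' 0 - x' 1|) := by
        gcongr
        exact (abs_add_le _ _).trans_eq (by rw [abs_mul, abs_two])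
    _ ≤ η / 2 * (2 * (2 * d) + 2 * d') := by
        gcongr
        · exact (abs_sub_le_two_mul_dist_uniform x).trans (by gcongr)
        · exact (abs_sub_le_two_mul_dist_uniform x').trans (by gcongr)
    _ = η * (2 * d + d') := by ring

lemma maxBias_le_maxBias_omwuStep_add {η : ℝ} (hη : 0 ≤ η) (t : ℤ) (z' : Profile 2 2)
    {z : Profile 2 2} (h₁ : ∀ i, 0 < z.1 i) (h₂ : ∀ i, 0 < z.2 i) :
    maxBias (halfLogOdds z.1) (halfLogOdds z.2) ≤
      maxBias (halfLogOdds (omwuStep η (periodicGame (t - 1)) (periodicGame t) z' z).1)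
          (halfLogOdds (omwuStep η (periodicGame (t - 1)) (periodicGame t) z' z).2) +
        η * (2 * dist z equilibrium + dist z' equilibrium) := by
  apply maxBias_le_add
  · rw [halfLogOdds_omwuStep_fst η t z' h₁, add_sub_cancel_left]
    exact abs_half_mul_extrapolation_le hη t (le_max_right _ _) (le_max_right _ _)
  · rw [halfLogOdds_omwuStep_snd η t z' h₂, sub_sub_cancel_left, abs_neg]
    exact abs_half_mul_extrapolation_le hη t (le_max_left _ _) (le_max_left _ _)

lemma maxBias_le_three_mul_maxBias_omwuStep {η : ℝ} (hη : 0 ≤ η) (hη' : η ≤ 1 / 6) (t : ℤ)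
    {z' z : Profile 2 2} (h₁ : IsFullyMixed z.1) (h₂ : IsFullyMixed z.2)
    (hz' : η * dist z' equilibrium ≤ dist z equilibrium) :
    maxBias (halfLogOdds z.1) (halfLogOdds z.2) ≤
      3 * maxBias (halfLogOdds (omwuStep η (periodicGame (t - 1)) (periodicGame t) z' z).1)
        (halfLogOdds (omwuStep η (periodicGame (t - 1)) (periodicGame t) z' z).2) := by
  have hstep := maxBias_le_maxBias_omwuStep_add hη t z' h₁.2 h₂.2
  have hsmall := mul_le_mul_of_nonneg_right hη' (dist_nonneg (x := z) (y := equilibrium))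
  linarith [maxBias_halfLogOdds h₁ h₂]

lemma le_and_mul_dist_le_of_sqrt_le {η : ℝ} (hη : 0 ≤ η) {zm z0 : Profile 2 2}
    (hz0 : z0 ∈ mixedProfiles 2 2) (hzm : zm ∈ mixedProfiles 2 2)
    (h : 16 * √η ≤ 1 / 2 * dist z0 equilibrium) :
    η ≤ 1 / 105 ∧ η * dist zm equilibrium ≤ dist z0 equilibrium := by
  have hsqrt : √η ≤ 1 / 64 := by linarith [dist_equilibrium_le_half hz0]
  have hle : η ≤ 1 / 64 * √η := by
    nth_rewrite 1 [← mul_self_sqrt hη]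
    gcongr
  have := mul_le_mul_of_nonneg_left (dist_equilibrium_le_half hzm) hη
  exact ⟨by linarith, by linarith [sqrt_nonneg η]⟩

theorem tendsto_klProfile_omwu {η : ℝ} {zm z0 : Profile 2 2} (hη : 0 < η) (hη' : η ≤ 1 / 105)
    (hz0 : z0 ∈ mixedProfiles 2 2) (hne : z0 ≠ equilibrium)
    (hzm : η * dist zm equilibrium ≤ dist z0 equilibrium) :
    Tendsto (fun t => klProfile equilibrium (omwu η periodicGame zm z0 t)) atTop (𝓝 ⊤) := by
  by_cases hboundary : (∃ i, z0.1 i = 0) ∨ ∃ i, z0.2 i = 0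
  · have htop (t : ℕ) : klProfile equilibrium (omwu η periodicGame zm z0 t) = ⊤ :=
      klProfile_eq_top <| hboundary.imp
        (fun ⟨i, hi⟩ => ⟨i, equilibrium_fst_ne_zero i, omwu_fst_eq_zero hi t⟩)
        (fun ⟨i, hi⟩ => ⟨i, equilibrium_snd_ne_zero i, omwu_snd_eq_zero hi t⟩)
    simp only [htop, tendsto_const_nhds]
  · push Not at hboundary
    have h₁ := isFullyMixed_of_ne_zero hz0.1 hboundary.1
    have h₂ := isFullyMixed_of_ne_zero hz0.2 hboundary.2
    have hdiv := (isLogOddsOrbit_omwu h₁ h₂).tendsto_equilibriumKL (half_pos hη) (by linarith)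
      (maxBias_le_three_mul_maxBias_omwuStep hη.le (by linarith) 0 h₁ h₂ hzm)
      (halfLogOdds_ne_zero_of_ne_equilibrium h₁ h₂ hne)
    refine (EReal.tendsto_coe_nhds_top_iff.2 hdiv).congr fun t => ?_
    obtain ⟨ht₁, ht₂⟩ := isFullyMixed_omwu h₁ h₂ t
    exact (klProfile_equilibrium_of_isFullyMixed ht₁ ht₂).symm

theorem mainTheorem1_general {η : ℝ} (hη : 0 < η) (hη' : η ≤ 1 / 105) {zm z0 : Profile 2 2}
    (hz0 : z0 ∈ mixedProfiles 2 2) (hne : z0 ≠ equilibrium)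
    (hzm : η * dist zm equilibrium ≤ dist z0 equilibrium) :
    Tendsto (fun t => klProfile equilibrium (omwu η periodicGame zm z0 t)) atTop (𝓝 ⊤) ∧
      ¬ Tendsto (fun t => omwu η periodicGame zm z0 t) atTop (𝓝 equilibrium) :=
  have hdiv := tendsto_klProfile_omwu hη hη' hz0 hne hzm
  ⟨hdiv, not_tendsto_of_tendsto_klProfile_top equilibrium_fst_ne_zero equilibrium_snd_ne_zero hdiv⟩

end

theorem mainTheorem1 :
    (∀ z0 ∈ mixedProfiles 2 2, z0 ≠ equilibrium → ∀ zm ∈ mixedProfiles 2 2, ∀ η : ℝ, 0 < η →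
      16 * Real.sqrt η ≤
        (1 / 2) * max |z0.1 0 - equilibrium.1 0| |z0.2 0 - equilibrium.2 0| →
      Tendsto (fun t => klProfile equilibrium (omwu η periodicGame zm z0 t)) atTop (𝓝 ⊤) ∧
      ¬ Tendsto (fun t => omwu η periodicGame zm z0 t) atTop (𝓝 equilibrium)) ∧
    (∃ η₀ : ℝ, 0 < η₀ ∧ ∀ η : ℝ, 0 < η → η < η₀ →
      ∀ z0 ∈ mixedProfiles 2 2, z0 ≠ equilibrium →
      Tendsto (fun t => klProfile equilibrium (omwu η periodicGame z0 z0 t)) atTop (𝓝 ⊤) ∧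
      ¬ Tendsto (fun t => omwu η periodicGame z0 z0 t) atTop (𝓝 equilibrium)) := by
  refine ⟨fun z0 hz0 hne zm hzm η hη hp => ?_, 1 / 105, by norm_num,
    fun η hη hη' z0 hz0 hne => ?_⟩
  · rw [← dist_equilibrium_of_mem hz0] at hp
    obtain ⟨hη', hdist⟩ := le_and_mul_dist_le_of_sqrt_le hη.le hz0 hzm hp
    exact mainTheorem1_general hη hη' hz0 hne hdist
  · exact mainTheorem1_general hη hη'.le hz0 hne
      (mul_le_of_le_one_left dist_nonneg (by linarith))
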